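/- Let $c\in\{-1,0,1,2,\dots\}$, $m\in\mathbb Z$, $\alpha\ge 1$ and $0\le\beta\le 1$. Let $I_c=[0,\infty)$ if $c\ge 0$ and $I_{-1}=[0,1]$, and put $\varphi(x)=\sqrt{x(1+cx)}$ for $x\in I_c$. For real $\nu$ let $\phi_{\nu,0}(x)=e^{-\nu x}$ and $\phi_{\nu,c}(x)=(1+cx)^{-\nu/c}$ for $c\ne 0$, and for $k=0,1,2,\dots$ let $$p_{\nu,k}(x;c)=\frac{(-x)^k}{k!}\,\phi_{\nu,c}^{(k)}(x),\qquad J_{\nu,k}(x;c)=\sum_{j\ge k}p_{\nu,j}(x;c),\qquad Q^{(\alpha)}_{\nu,k}(x;c)=J_{\nu,k}(x;c)^\alpha-J_{\nu,k+1}(x;c)^\alpha .$$ For a bounded continuous function $f$ on $I_c$ define $$F_{n,m}^{c,\alpha}(f;x)=\{n+(m+1)c\}\sum_{k=1}^\infty Q^{(\alpha)}_{n+mc,k}(x;c)\int_{I_c}p_{n+(m+2)c,k-1}(t;c)f(t)\,dt+Q^{(\alpha)}_{n+mc,0}(x;c)f(0)+E_n(f;x),$$ where $E_n(f;x)=0$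 if $c\ge 0$, and $E_n(f;x)=Q^{(\alpha)}_{n-m,n-m}(x;-1)f(1)$ if $c=-1$. For $\delta\ge 0$ let $$\omega_{\varphi^\beta}(f;\delta)=\sup_{0\le h\le\delta}\ \sup_{x\pm h\varphi^\beta(x)/2\in I_c}\left|f\Big(x+\tfrac{h\varphi^\beta(x)}2\Big)-f\Big(x-\tfrac{h\varphi^\beta(x)}2\Big)\right|$$ be the Ditzian–Totik modulus of smoothness (with $0^0=1$). Then there are a constant $C>0$ and $n_0\in\mathbb N$, depending only on $c,m,\alpha,\beta$, such that for all $n\ge n_0$, all bounded continuous $f:I_c\to\mathbb R$ and all $x\in I_c$, $$\left|F_{n,m}^{c,\alpha}(f;x)-f(x)\right|\le C\,\omega_{\varphi^\beta}\!\left(f;\frac{\varphi^{1-\beta}(x)}{\sqrt n}\right).$$ -/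

import Mathlib

open Filter

namespace GuptaSrivastava

/-- The interval on which the operators with parameter `c` live: the points `x ≥ 0` with
`1 + c x ≥ 0`.  It is `[0, ∞)` for `c ≥ 0` and `[0, 1]` for `c = -1`. -/
def dom (c : ℤ) : Set ℝ := {x | 0 ≤ x ∧ 0 ≤ 1 + (c : ℝ) * x}

theorem dom_of_nonneg {c : ℤ} (hc : 0 ≤ c) : dom c = Set.Ici 0 := by
  have hc' : (0 : ℝ) ≤ c := by exact_mod_cast hc
  ext x
  simp only [dom, Set.mem_ofPred_eq, Set.mem_Ici]
  exact ⟨fun h => h.1, fun h => ⟨h, by positivity⟩⟩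

theorem dom_neg_one : dom (-1) = Set.Icc 0 1 := by
  ext x
  simp only [dom, Set.mem_ofPred_eq, Set.mem_Icc, Int.cast_neg, Int.cast_one]
  constructor <;> rintro ⟨h1, h2⟩ <;> constructor <;> linarith

/-- The generating function: `e^{-νx}` for `c = 0`, and `(1 + c x)^{-ν/c}` for `c ≠ 0`
(so `(1 - x)^ν` for `c = -1`). -/
noncomputable def gen (ν : ℝ) (c : ℤ) (x : ℝ) : ℝ :=
  if c = 0 then Real.exp (-(ν * x)) else (1 + (c : ℝ) * x) ^ (-(ν / (c : ℝ)))

/-- The basis functions `p_{ν,k}(x;c) = (-x)^k / k! · (d/dx)^k gen_{ν,c}(x)`. -/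
noncomputable def p (ν : ℝ) (c : ℤ) (k : ℕ) (x : ℝ) : ℝ :=
  (-x) ^ k / (k.factorial : ℝ) * iteratedDeriv k (gen ν c) x

/-- The tails `J_{ν,k}(x;c) = ∑_{j ≥ k} p_{ν,j}(x;c)`. -/
noncomputable def J (ν : ℝ) (c : ℤ) (k : ℕ) (x : ℝ) : ℝ :=
  ∑' j : ℕ, p ν c (k + j) x

/-- The Bézier weights `Q^{(α)}_{ν,k}(x;c) = J_{ν,k}(x;c)^α - J_{ν,k+1}(x;c)^α`. -/
noncomputable def Q (α ν : ℝ) (c : ℤ) (k : ℕ) (x : ℝ) : ℝ :=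
  J ν c k x ^ α - J ν c (k + 1) x ^ α

/-- The Bézier variant `F_{n,m}^{c,α}(f; x)` of the Gupta–Srivastava operators.  The series runs
over the indices `k + 1 = 1, 2, …`.  For `c = -1` (the Bernstein–Durrmeyer case) it stops by itself
before the index `n - m`, and the weight of that last index multiplies `f(1)`, just as the weight
of the index `0` multiplies `f(0)`. -/
noncomputable def F (n : ℕ) (m c : ℤ) (α : ℝ) (f : ℝ → ℝ) (x : ℝ) : ℝ :=
  ((n : ℝ) + (m + 1) * c) *
      (∑' k : ℕ, Q α (n + m * c) c (k + 1) x *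
        (∫ t in dom c, (p (n + (m + 2) * c) c k t * f t)))
    + Q α (n + m * c) c 0 x * f 0
    + (if c = -1 then Q α (n + m * c) c ((n : ℤ) - m).toNat x * f 1 else 0)

/-- The weight `φ(x) = √(x (1 + c x))`. -/
noncomputable def phi (c : ℤ) (x : ℝ) : ℝ := Real.sqrt (x * (1 + (c : ℝ) * x))

/-- The first order Ditzian–Totik modulus of smoothness `ω_{φ^β}(f; δ)` on `dom c`: the supremum of
`|f(x + hφ^β(x)/2) - f(x - hφ^β(x)/2)|` over `0 ≤ h ≤ δ` and all `x` for which both points lie in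
`dom c`. -/
noncomputable def omega (c : ℤ) (β : ℝ) (f : ℝ → ℝ) (δ : ℝ) : ℝ :=
  sSup {r : ℝ | ∃ h x : ℝ, 0 ≤ h ∧ h ≤ δ ∧
    x + h * phi c x ^ β / 2 ∈ dom c ∧ x - h * phi c x ^ β / 2 ∈ dom c ∧
    r = |f (x + h * phi c x ^ β / 2) - f (x - h * phi c x ^ β / 2)|}

end GuptaSrivastava

/-!
# Rate of approximation of the Bézier–Gupta–Srivastava operators

The operator is a weighted mean `∑ Q_k L_k f` of functionals `L_k` (`node`): point evaluations at
the endpoints and integrals against normalized basis functions in between. The Bézier weights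
satisfy `0 ≤ Q_k ≤ α p_k` and `∑ Q_k = 1`, because `u ↦ u ^ α` is `α`-Lipschitz on `[0, 1]` and the
tails `J_k` decrease from `1` to `0`. Hence a bound `|f t - f x| ≤ W t` gives
`|F f x - f x| ≤ α ∑ p_k(x) L_k W`, which only involves the operator with `α = 1`.

The majorant `W` comes from chaining. If `|s - t| √n` is at most `φ(x)` and at most `φ(y)`, where
`y` is the midpoint of `s` and `t`, then it is at most `φ(x)^{1-β} φ(y)^β`, so that `|f s - f t|` is
one of the differences in the modulus `Λ = ω_{φ^β}(f; φ(x)^{1-β} / √n)`. This condition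
(`StepBound`) does not involve `β`. Counting the steps needed to go from `x` to `t`, uniform where
`φ ≥ φ(x)` and uniform in `√u` below `x`, gives
`|f t - f x| ≤ Λ (5 + n (t - x)² / φ(x)² + (1 + c x) / (1 + c t))`, with the last term only for
`c ≥ 0`; for `c = -1` the symmetry `u ↦ 1 - u` takes care of the second endpoint.

The moments of `W` are explicit. With the product `rise ν c k = ν (ν + c) ⋯ (ν + (k - 1) c)` the
basis is `rise ν c k / k! · x ^ k · gen (ν + k c) x` for all `c` alike, and multiplication by `x` or
by `1 + c x` just shifts its parameters. The derivative of `∑_{j ≤ k} p_{ν,j}` telescopes to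
`-ν p_{ν+c,k}`; this yields in turn that the partial sums are at most one, that the full sum is one,
and that `∫ p_{ν+c,k} = 1 / ν`. The second central moment is `2 φ(x)² / (ν - c)`, which cancels
`n / φ(x)²`. At the endpoints, where `φ` vanishes, the operator interpolates `f`.
-/

namespace GuptaSrivastava

/-! ### The basis functions in closed form -/

/-- The product `ν (ν + c) ⋯ (ν + (k - 1) c)`, a rising factorial with step `c`. -/
noncomputable def rise (ν : ℝ) (c : ℤ) (k : ℕ) : ℝ := ∏ i ∈ Finset.range k, (ν + i * c)

/-- The closed form of `p ν c k`, valid wherever `1 + c x > 0`. -/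
noncomputable def bas (ν : ℝ) (c : ℤ) (k : ℕ) (x : ℝ) : ℝ :=
  rise ν c k / (k.factorial : ℝ) * x ^ k * gen (ν + k * c) c x

theorem rise_succ (ν : ℝ) (c : ℤ) (k : ℕ) : rise ν c (k + 1) = rise ν c k * (ν + k * c) := by
  simp [rise, Finset.prod_range_succ]

theorem rise_succ' (ν : ℝ) (c : ℤ) (k : ℕ) : rise ν c (k + 1) = ν * rise (ν + c) c k := by
  rw [rise, Finset.prod_range_succ', mul_comm]
  simp only [rise]
  congr 1
  · simp
  · refine Finset.prod_congr rfl fun i _ => ?_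
    push_cast
    ring

theorem rise_add_nonneg {ν : ℝ} {c : ℤ} (hν : 0 < ν) (h : ∀ k, 0 ≤ rise ν c k) (k : ℕ) :
    0 ≤ rise (ν + c) c k := by
  have := h (k + 1)
  rw [rise_succ'] at this
  exact nonneg_of_mul_nonneg_right this hν

theorem rise_natCast_eq_zero {N k : ℕ} (h : N < k) : rise N (-1) k = 0 := by
  refine Finset.prod_eq_zero (Finset.mem_range.2 h) ?_
  simp

theorem rise_natCast_nonneg {c : ℤ} (hc : -1 ≤ c) (N k : ℕ) : 0 ≤ rise N c k := by
  rcases hc.eq_or_lt with rfl | hc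
  · rcases lt_or_ge N k with h | h
    · rw [rise_natCast_eq_zero h]
    · refine Finset.prod_nonneg fun i hi => ?_
      have : (i : ℝ) ≤ N := by exact_mod_cast (Finset.mem_range.1 hi).le.trans h
      push_cast
      linarith
  · have hc' : (0 : ℝ) ≤ c := by exact_mod_cast (by omega : 0 ≤ c)
    exact Finset.prod_nonneg fun i _ => by positivity

theorem gen_apply_zero (ν : ℝ) (c : ℤ) : gen ν c 0 = 1 := by
  simp [gen]

theorem gen_pos (ν : ℝ) {c : ℤ} {x : ℝ} (hx : 0 < 1 + (c : ℝ) * x) : 0 < gen ν c x := by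
  unfold gen
  split_ifs
  · positivity
  · positivity

theorem gen_add_mul (ν : ℝ) {c : ℤ} {x : ℝ} (hx : 0 < 1 + (c : ℝ) * x) :
    gen (ν + c) c x * (1 + c * x) = gen ν c x := by
  unfold gen
  split_ifs with h
  · simp [h]
  · have h' : (c : ℝ) ≠ 0 := by exact_mod_cast h
    rw [← Real.rpow_add_one hx.ne']
    congr 1
    field_simp
    ring

theorem hasDerivAt_gen (ν : ℝ) {c : ℤ} {x : ℝ} (hx : 0 < 1 + (c : ℝ) * x) :
    HasDerivAt (gen ν c) (-ν * gen (ν + c) c x) x := by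
  by_cases h : c = 0
  · subst h
    have : gen ν 0 = fun x => Real.exp (-ν * x) := by ext; simp [gen]
    rw [this]
    have h1 : HasDerivAt (fun x : ℝ => -ν * x) (-ν) x := by
      simpa using (hasDerivAt_id x).const_mul (-ν)
    simpa [gen, mul_comm] using h1.exp
  · have h' : (c : ℝ) ≠ 0 := by exact_mod_cast h
    have : gen ν c = fun x => (1 + (c : ℝ) * x) ^ (-(ν / (c : ℝ))) := by ext; simp [gen, h]
    rw [this]
    have h1 : HasDerivAt (fun x : ℝ => 1 + (c : ℝ) * x) c x := by
      simpa using ((hasDerivAt_id x).const_mul (c : ℝ)).const_add 1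
    convert h1.rpow_const (p := -(ν / (c : ℝ))) (Or.inl hx.ne') using 1
    simp only [gen, h, if_false]
    rw [show -((ν + c) / (c : ℝ)) = -(ν / (c : ℝ)) - 1 by field_simp; ring]
    field_simp

theorem isOpen_pos (c : ℤ) : IsOpen {x : ℝ | 0 < 1 + (c : ℝ) * x} :=
  isOpen_lt continuous_const (by fun_prop)

theorem iteratedDeriv_gen (ν : ℝ) {c : ℤ} (k : ℕ) :
    ∀ {x : ℝ}, 0 < 1 + (c : ℝ) * x →
      iteratedDeriv k (gen ν c) x = (-1) ^ k * rise ν c k * gen (ν + k * c) c x := by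
  induction k with
  | zero => intro x _; simp [rise]
  | succ k ih =>
    intro x hx
    have h1 : iteratedDeriv k (gen ν c) =ᶠ[nhds x]
        fun y => (-1) ^ k * rise ν c k * gen (ν + k * c) c y := by
      filter_upwards [(isOpen_pos c).mem_nhds hx] with y hy using ih hy
    rw [iteratedDeriv_succ, h1.deriv_eq, ((hasDerivAt_gen (ν + k * c) hx).const_mul _).deriv,
      rise_succ, show ν + (k : ℝ) * c + c = ν + ((k + 1 : ℕ) : ℝ) * c by push_cast; ring]
    ring

theorem p_eq_bas (ν : ℝ) {c : ℤ} (k : ℕ) {x : ℝ} (hx : 0 < 1 + (c : ℝ) * x) :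
    p ν c k x = bas ν c k x := by
  rw [p, iteratedDeriv_gen ν k hx, bas, neg_pow x k]
  have : ((-1 : ℝ) ^ k) * (-1) ^ k = 1 := by rw [← mul_pow]; simp
  linear_combination (x ^ k / (k.factorial : ℝ) * rise ν c k * gen (ν + k * c) c x) * this

theorem bas_nonneg {ν : ℝ} {c : ℤ} {k : ℕ} {x : ℝ} (h : 0 ≤ rise ν c k) (hx₀ : 0 ≤ x)
    (hx : 0 < 1 + (c : ℝ) * x) : 0 ≤ bas ν c k x := by
  have := (gen_pos (ν + k * c) hx).le
  unfold bas
  positivity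

theorem bas_apply_zero (ν : ℝ) (c : ℤ) (k : ℕ) : bas ν c k 0 = if k = 0 then 1 else 0 := by
  by_cases h : k = 0 <;> simp [bas, h, rise, gen_apply_zero]

/-- Multiplication by `x` lowers the parameter by `c` and raises the index. This one relation
gives both the moments of the basis and those of the integrals. -/
theorem mul_bas_add (ν : ℝ) (c : ℤ) (k : ℕ) (x : ℝ) :
    ν * (x * bas (ν + c) c k x) = (k + 1) * bas ν c (k + 1) x := by
  simp only [bas]
  rw [rise_succ', show ν + (c : ℝ) + k * c = ν + ((k + 1 : ℕ) : ℝ) * c by push_cast; ring,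
    Nat.factorial_succ]
  push_cast
  field_simp
  ring

/-- Multiplication by `1 + c x` lowers the parameter by `c`; read backwards, it turns the test
function `1 / (1 + c t)` into a shift of the parameter. -/
theorem one_add_mul_bas_add (ν : ℝ) {c : ℤ} (k : ℕ) {x : ℝ} (hx : 0 < 1 + (c : ℝ) * x) :
    ν * ((1 + c * x) * bas (ν + c) c k x) = (ν + k * c) * bas ν c k x := by
  simp only [bas]
  have h := (rise_succ' ν c k).symm.trans (rise_succ ν c k)
  have hg := gen_add_mul (ν + k * c) hx
  rw [show ν + (k : ℝ) * c + c = ν + c + k * c by ring] at hg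
  rw [← hg]
  linear_combination
    (x ^ k / (k.factorial : ℝ) * gen (ν + c + k * c) c x * (1 + c * x)) * h

/-- The derivative of a partial sum of the basis telescopes to a single basis function. -/
theorem hasDerivAt_sum_bas (ν : ℝ) {c : ℤ} (k : ℕ) {x : ℝ} (hx : 0 < 1 + (c : ℝ) * x) :
    HasDerivAt (fun x => ∑ j ∈ Finset.range (k + 1), bas ν c j x)
      (-(ν * bas (ν + c) c k x)) x := by
  induction k with
  | zero => simpa [bas, rise] using hasDerivAt_gen ν hx
  | succ k ih =>
    simp_rw [Finset.sum_range_succ _ (k + 1)]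
    have h1 := (((hasDerivAt_pow (k + 1) x).const_mul
      (rise ν c (k + 1) / ((k + 1).factorial : ℝ))).mul
        (hasDerivAt_gen (ν + (k + 1 : ℕ) * c) hx))
    refine (ih.add h1).congr_deriv ?_
    have e1 := rise_succ' ν c k
    have e2 := (rise_succ' ν c (k + 1)).symm.trans (rise_succ ν c (k + 1))
    simp only [bas, Nat.add_sub_cancel]
    rw [show ν + (c : ℝ) + k * c = ν + ((k + 1 : ℕ) : ℝ) * c by push_cast; ring,
      show ν + (c : ℝ) + ((k + 1 : ℕ) : ℝ) * c = ν + ((k + 1 : ℕ) : ℝ) * c + c by ring]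
    have e3 : ((k + 1).factorial : ℝ) = (k + 1) * k.factorial := by
      rw [Nat.factorial_succ]; push_cast; ring
    have hk : ((k : ℝ) + 1) ≠ 0 := by positivity
    have hf : (k.factorial : ℝ) ≠ 0 := by positivity
    generalize gen (ν + ((k + 1 : ℕ) : ℝ) * c + c) c x = G at *
    generalize gen (ν + ((k + 1 : ℕ) : ℝ) * c) c x = H at *
    rw [e3]
    rw [e1] at e2 ⊢
    push_cast at e2 ⊢
    field_simp
    linear_combination (x ^ (k + 1) * G) * e2

/-! ### The basis as a probability distribution -/

theorem one_add_mul_pos_of_le {c : ℤ} {x y : ℝ} (hx : 0 < 1 + (c : ℝ) * x) (hy₀ : 0 ≤ y)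
    (hyx : y ≤ x) : 0 < 1 + (c : ℝ) * y := by
  rcases le_or_gt 0 (c : ℝ) with h | h
  · positivity
  · nlinarith

theorem mul_bas_add_nonneg {ν : ℝ} {c : ℤ} (h : ∀ k, 0 ≤ rise ν c k) (k : ℕ) {x : ℝ}
    (hx₀ : 0 ≤ x) (hx : 0 < 1 + (c : ℝ) * x) : 0 ≤ ν * bas (ν + c) c k x := by
  have h1 := h (k + 1)
  rw [rise_succ'] at h1
  have h2 := (gen_pos (ν + c + k * c) hx).le
  have : ν * bas (ν + c) c k x =
      ν * rise (ν + c) c k * (x ^ k / (k.factorial : ℝ) * gen (ν + c + k * c) c x) := by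
    simp only [bas]; ring
  rw [this]
  positivity

theorem sum_bas_apply_zero (ν : ℝ) (c : ℤ) (k : ℕ) :
    ∑ j ∈ Finset.range (k + 1), bas ν c j 0 = 1 := by
  simp [bas_apply_zero]

theorem continuousOn_sum_bas (ν : ℝ) {c : ℤ} (k : ℕ) {x : ℝ} (hx : 0 < 1 + (c : ℝ) * x) :
    ContinuousOn (fun x => ∑ j ∈ Finset.range (k + 1), bas ν c j x) (Set.Icc 0 x) :=
  fun _ hy => (hasDerivAt_sum_bas ν k
    (one_add_mul_pos_of_le hx hy.1 hy.2)).continuousAt.continuousWithinAt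

theorem sum_bas_le_one {ν : ℝ} {c : ℤ} (h : ∀ k, 0 ≤ rise ν c k) (k : ℕ) {x : ℝ}
    (hx₀ : 0 ≤ x) (hx : 0 < 1 + (c : ℝ) * x) :
    ∑ j ∈ Finset.range (k + 1), bas ν c j x ≤ 1 := by
  have hanti : AntitoneOn (fun x => ∑ j ∈ Finset.range (k + 1), bas ν c j x) (Set.Icc 0 x) := by
    refine antitoneOn_of_deriv_nonpos (convex_Icc 0 x) (continuousOn_sum_bas ν k hx) ?_ ?_
    · intro y hy
      rw [interior_Icc] at hy
      exact (hasDerivAt_sum_bas ν k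
        (one_add_mul_pos_of_le hx hy.1.le hy.2.le)).differentiableAt.differentiableWithinAt
    · intro y hy
      rw [interior_Icc] at hy
      have hy' := one_add_mul_pos_of_le hx hy.1.le hy.2.le
      rw [(hasDerivAt_sum_bas ν k hy').deriv]
      linarith [mul_bas_add_nonneg h k hy.1.le hy']
  have := hanti (Set.left_mem_Icc.2 hx₀) (Set.right_mem_Icc.2 hx₀) hx₀
  simpa only [sum_bas_apply_zero] using this

theorem bas_le_one {ν : ℝ} {c : ℤ} (h : ∀ k, 0 ≤ rise ν c k) (k : ℕ) {x : ℝ}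
    (hx₀ : 0 ≤ x) (hx : 0 < 1 + (c : ℝ) * x) : bas ν c k x ≤ 1 :=
  (Finset.single_le_sum (fun j _ => bas_nonneg (h j) hx₀ hx)
    (Finset.self_mem_range_succ k)).trans (sum_bas_le_one h k hx₀ hx)

/-- The defect of the `k`-th partial sum is `ν ∫₀ˣ bas (ν + c) k`, and the integrand is at most
`(ν + c) x / k` because the functions `bas (ν + 2c)` are bounded by one. -/
theorem one_sub_sum_bas_le {ν : ℝ} {c : ℤ} (h : ∀ k, 0 ≤ rise ν c k) (hν : 0 < ν)
    (hνc : 0 < ν + c) (k : ℕ) {x : ℝ} (hx₀ : 0 ≤ x) (hx : 0 < 1 + (c : ℝ) * x) :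
    1 - ∑ j ∈ Finset.range (k + 1 + 1), bas ν c j x ≤ ν * ((ν + c) * x / (k + 1)) * x := by
  set M := ν * ((ν + c) * x / (k + 1)) with hM
  have hder : ∀ y ∈ Set.Icc 0 x, HasDerivAt
      (fun x => ∑ j ∈ Finset.range (k + 1 + 1), bas ν c j x + M * x)
      (-(ν * bas (ν + c) c (k + 1) y) + M) y := fun y hy => by
    simpa using (hasDerivAt_sum_bas ν (k + 1) (one_add_mul_pos_of_le hx hy.1 hy.2)).fun_add
      ((hasDerivAt_id' y).const_mul M)
  have hmono : MonotoneOn (fun x => ∑ j ∈ Finset.range (k + 1 + 1), bas ν c j x + M * x)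
      (Set.Icc 0 x) := by
    refine monotoneOn_of_deriv_nonneg (convex_Icc 0 x)
      (fun y hy => (hder y hy).continuousAt.continuousWithinAt) ?_ ?_
    · intro y hy
      exact (hder y (interior_subset hy)).differentiableAt.differentiableWithinAt
    · intro y hy
      have hy := interior_subset hy
      have hy' := one_add_mul_pos_of_le hx hy.1 hy.2
      rw [(hder y hy).deriv]
      have h1 := mul_bas_add (ν + c) c k y
      have h2 := bas_le_one (rise_add_nonneg hνc (rise_add_nonneg hν h)) k hy.1 hy'
      have h3 : y * bas (ν + c + c) c k y ≤ x := by
        nlinarith [mul_le_mul_of_nonneg_left h2 hy.1, hy.2]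
      have h4 : bas (ν + c) c (k + 1) y ≤ (ν + c) * x / (k + 1) := by
        rw [le_div_iff₀ (by positivity), mul_comm, ← h1]
        exact mul_le_mul_of_nonneg_left h3 hνc.le
      have := mul_le_mul_of_nonneg_left h4 hν.le
      linarith
  have := hmono (Set.left_mem_Icc.2 hx₀) (Set.right_mem_Icc.2 hx₀) hx₀
  simp only [sum_bas_apply_zero] at this
  linarith

theorem hasSum_bas {ν : ℝ} {c : ℤ} (h : ∀ k, 0 ≤ rise ν c k) (hν : 0 < ν)
    (hνc : 0 < ν + c) {x : ℝ} (hx₀ : 0 ≤ x) (hx : 0 < 1 + (c : ℝ) * x) :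
    HasSum (fun k => bas ν c k x) 1 := by
  rw [hasSum_iff_tendsto_nat_of_nonneg (fun k => bas_nonneg (h k) hx₀ hx),
    ← tendsto_add_atTop_iff_nat 2]
  refine tendsto_of_tendsto_of_tendsto_of_le_of_le
    (g := fun k : ℕ => 1 - ν * (ν + c) * x * x * (1 / ((k : ℝ) + 1))) ?_ tendsto_const_nhds
    (fun k => ?_) (fun k => sum_bas_le_one h (k + 1) hx₀ hx)
  · simpa using (tendsto_one_div_add_atTop_nhds_zero_nat (𝕜 := ℝ)).const_mul
      (ν * (ν + c) * x * x) |>.const_sub 1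
  · have := one_sub_sum_bas_le h hν hνc k hx₀ hx
    simp only
    have e : ν * ((ν + c) * x / (k + 1)) * x = ν * (ν + c) * x * x * (1 / ((k : ℝ) + 1)) := by
      ring
    linarith

/-! ### Integrals of the basis functions -/

/-- Since `x · bas (ν + c) k x` is a multiple of `bas ν (k + 1) x ≤ 1`, the basis functions decay
at least like `1 / x`. -/
theorem tendsto_bas_atTop {ν : ℝ} {c : ℤ} (hc : 0 ≤ c) (hν : 0 < ν)
    (h : ∀ k, 0 ≤ rise ν c k) (k : ℕ) : Tendsto (bas (ν + c) c k) atTop (nhds 0) := by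
  have hc' : (0 : ℝ) ≤ c := by exact_mod_cast hc
  refine tendsto_of_tendsto_of_tendsto_of_le_of_le' (h := fun x => (k + 1) / ν * x⁻¹)
    tendsto_const_nhds ?_ ?_ ?_
  · simpa using tendsto_inv_atTop_zero.const_mul (((k : ℝ) + 1) / ν)
  · filter_upwards [eventually_gt_atTop 0] with x hx
    exact bas_nonneg (rise_add_nonneg hν h k) hx.le (by positivity)
  · filter_upwards [eventually_gt_atTop 0] with x hx
    have h1 := mul_bas_add ν c k x
    have h2 := bas_le_one h (k + 1) hx.le (by positivity)
    have h3 : ν * (x * bas (ν + c) c k x) ≤ k + 1 := by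
      rw [h1]; nlinarith [(Nat.cast_nonneg k : (0 : ℝ) ≤ k)]
    rw [div_mul_eq_mul_div, le_div_iff₀ hν, ← div_eq_mul_inv, le_div_iff₀ hx]
    linarith

theorem integral_bas_of_nonneg {ν : ℝ} {c : ℤ} (hc : 0 ≤ c) (hν : 0 < ν)
    (h : ∀ k, 0 ≤ rise ν c k) (k : ℕ) :
    MeasureTheory.IntegrableOn (bas (ν + c + c) c k) (dom c) ∧
      ∫ t in dom c, bas (ν + c + c) c k t = 1 / (ν + c) := by
  have hc' : (0 : ℝ) ≤ c := by exact_mod_cast hc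
  have hνc : 0 < ν + c := by positivity
  have h' := rise_add_nonneg hν h
  have hder : ∀ x ∈ Set.Ici (0 : ℝ), HasDerivAt
      (fun x => -((ν + c)⁻¹ * ∑ j ∈ Finset.range (k + 1), bas (ν + c) c j x))
      (bas (ν + c + c) c k x) x := fun x hx => by
    have hx : 0 ≤ x := hx
    refine ((hasDerivAt_sum_bas (ν + c) k (by positivity)).const_mul _).neg.congr_deriv ?_
    field_simp
  have hpos : ∀ x ∈ Set.Ioi (0 : ℝ), 0 ≤ bas (ν + c + c) c k x := fun x hx => by
    have hx : 0 < x := hx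
    exact bas_nonneg (rise_add_nonneg hνc h' k) hx.le (by positivity)
  have hlim : Tendsto (fun x => -((ν + c)⁻¹ * ∑ j ∈ Finset.range (k + 1), bas (ν + c) c j x))
      atTop (nhds 0) := by
    simpa using ((tendsto_finsetSum (Finset.range (k + 1))
      fun j _ => tendsto_bas_atTop hc hν h j).const_mul (ν + c)⁻¹).neg
  rw [dom_of_nonneg hc, integrableOn_Ici_iff_integrableOn_Ioi,
    MeasureTheory.integral_Ici_eq_integral_Ioi]
  refine ⟨MeasureTheory.integrableOn_Ioi_deriv_of_nonneg' hder hpos hlim, ?_⟩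
  rw [MeasureTheory.integral_Ioi_of_hasDerivAt_of_nonneg' hder hpos hlim]
  simp [sum_bas_apply_zero]

theorem integral_bas_neg_one {ν : ℝ} (h : ∀ k, 0 ≤ rise ν (-1) k) {k : ℕ} (hk : (k : ℝ) < ν) :
    MeasureTheory.IntegrableOn (bas (ν + (-1 : ℤ)) (-1) k) (dom (-1)) ∧
      ∫ t in dom (-1), bas (ν + (-1 : ℤ)) (-1) k t = 1 / ν := by
  have hν : 0 < ν := (Nat.cast_nonneg k).trans_lt hk
  have hder : ∀ x ∈ Set.Ioo (0 : ℝ) 1, HasDerivAt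
      (fun x => -(ν⁻¹ * ∑ j ∈ Finset.range (k + 1), bas ν (-1) j x))
      (bas (ν + (-1 : ℤ)) (-1) k x) x := fun x hx => by
    refine ((hasDerivAt_sum_bas ν k ?_).const_mul _).neg.congr_deriv ?_
    · push_cast; linarith [hx.2]
    · field_simp
  have hpos : ∀ x ∈ Set.Ioo (0 : ℝ) 1, 0 ≤ bas (ν + (-1 : ℤ)) (-1) k x := fun x hx =>
    bas_nonneg (rise_add_nonneg hν h k) hx.1.le (by push_cast; linarith [hx.2])
  have hgen : ∀ j ∈ Finset.range (k + 1),
      gen (ν + j * ((-1 : ℤ) : ℝ)) (-1) = (fun x : ℝ => (1 - x) ^ (ν - j)) ∧ 0 < ν - j := by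
    intro j hj
    have hj' : (j : ℝ) ≤ k := by exact_mod_cast Finset.mem_range_succ_iff.1 hj
    refine ⟨?_, by linarith⟩
    ext x
    simp only [gen]
    norm_num
    ring_nf
  have hcont : ContinuousOn (fun x => -(ν⁻¹ * ∑ j ∈ Finset.range (k + 1), bas ν (-1) j x))
      (Set.Icc 0 1) := by
    refine Continuous.continuousOn (Continuous.neg (continuous_const.mul
      (continuous_finsetSum _ fun j hj => ?_)))
    obtain ⟨h1, h2⟩ := hgen j hj
    unfold bas
    rw [h1]
    exact (continuous_const.mul (continuous_pow j)).mul
      ((continuous_const.sub continuous_id).rpow_const fun _ => Or.inr h2.le)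
  have hint : IntervalIntegrable (bas (ν + (-1 : ℤ)) (-1) k) MeasureTheory.volume 0 1 := by
    refine intervalIntegral.intervalIntegrable_deriv_of_nonneg
      (by simpa using hcont) (by simpa using hder) (by simpa using hpos)
  have hone : ∑ j ∈ Finset.range (k + 1), bas ν (-1) j 1 = 0 := by
    refine Finset.sum_eq_zero fun j hj => ?_
    obtain ⟨h1, h2⟩ := hgen j hj
    rw [bas, h1]
    simp [Real.zero_rpow h2.ne']
  rw [dom_neg_one, integrableOn_Icc_iff_integrableOn_Ioc, MeasureTheory.integral_Icc_eq_integral_Ioc,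
    ← intervalIntegral.integral_of_le zero_le_one,
    intervalIntegral.integral_eq_sub_of_hasDerivAt_of_le zero_le_one hcont hder hint]
  refine ⟨(intervalIntegrable_iff_integrableOn_Ioc_of_le zero_le_one).1 hint, ?_⟩
  rw [hone, sum_bas_apply_zero]
  simp

/-! ### Chaining for the Ditzian–Totik modulus -/

/-- If `g` oscillates by at most `Λ` over steps of length `η`, then it oscillates by at most `Λ`
times the number of such steps over a longer interval. -/
theorem abs_sub_le_of_steps {g : ℝ → ℝ} {a b η Λ : ℝ} (hab : a ≤ b) (hη : 0 < η) (hΛ : 0 ≤ Λ)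
    (h : ∀ s ∈ Set.Icc a b, ∀ t ∈ Set.Icc a b, s ≤ t → t - s ≤ η → |g t - g s| ≤ Λ) :
    |g b - g a| ≤ Λ * (1 + (b - a) / η) := by
  have key : ∀ i : ℕ, |g (min b (a + i * η)) - g a| ≤ Λ * i := by
    intro i
    induction i with
    | zero => simp [hab]
    | succ i ih =>
      have hi : 0 ≤ i * η := by positivity
      have hle : a + i * η ≤ a + (i + 1 : ℕ) * η := by push_cast; linarith
      have hstep := h (min b (a + i * η)) ⟨le_min hab (by linarith), min_le_left _ _⟩
        (min b (a + (i + 1 : ℕ) * η)) ⟨le_min hab (by linarith), min_le_left _ _⟩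
        (min_le_min_left b hle) (by
          rcases le_total b (a + i * η) with h1 | h1
          · rw [min_eq_left h1, min_eq_left (h1.trans hle)]; linarith
          · rw [min_eq_right h1]
            have := min_le_right b (a + (i + 1 : ℕ) * η)
            push_cast at this ⊢
            linarith)
      calc _ ≤ |g (min b (a + (i + 1 : ℕ) * η)) - g (min b (a + i * η))|
            + |g (min b (a + i * η)) - g a| := abs_sub_le _ _ _
        _ ≤ Λ + Λ * i := add_le_add hstep ih
        _ = _ := by push_cast; ring
  have hq : 0 ≤ (b - a) / η := div_nonneg (by linarith) hη.le
  have h1 := key ⌈(b - a) / η⌉₊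
  have h2 := Nat.le_ceil ((b - a) / η)
  rw [div_le_iff₀ hη] at h2
  rw [min_eq_left (by linarith)] at h1
  refine h1.trans (mul_le_mul_of_nonneg_left ?_ hΛ)
  linarith [Nat.ceil_lt_add_one hq]

/-- `f` changes by at most `Λ` between points of the domain whose distance, times `r`, exceeds
neither `φ(x)` nor the value of `φ` at their midpoint. For `Λ = ω_{φ^β}(f; φ(x)^{1-β} / r)` this
holds whatever the exponent `β` is. -/
def StepBound (c : ℤ) (f : ℝ → ℝ) (x r Λ : ℝ) : Prop :=
  ∀ s ∈ dom c, ∀ t ∈ dom c, s ≤ t → r * (t - s) ≤ phi c x → r * (t - s) ≤ phi c ((s + t) / 2) →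
    |f t - f s| ≤ Λ

theorem phi_nonneg (c : ℤ) (x : ℝ) : 0 ≤ phi c x := Real.sqrt_nonneg _

theorem omega_nonneg (c : ℤ) (β : ℝ) (f : ℝ → ℝ) (δ : ℝ) : 0 ≤ omega c β f δ := by
  refine Real.sSup_nonneg ?_
  rintro r ⟨h, x, -, -, -, -, rfl⟩
  exact abs_nonneg _

/-- The number `r |s - t|` is at most `φ(x)^{1-β} φ(y)^β`, with `y` the midpoint, as soon as it is
at most both `φ(x)` and `φ(y)`; then the pair `s, t` competes in the modulus. -/
theorem stepBound_omega {c : ℤ} {β : ℝ} (hβ₀ : 0 ≤ β) (hβ₁ : β ≤ 1) {f : ℝ → ℝ} {M : ℝ}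
    (hM : ∀ x ∈ dom c, |f x| ≤ M) (x : ℝ) {r : ℝ} (hr : 0 < r) :
    StepBound c f x r (omega c β f (phi c x ^ (1 - β) / r)) := by
  intro s hs t ht hst h1 h2
  rcases hst.eq_or_lt with rfl | hst
  · simpa using omega_nonneg _ _ _ _
  set y := (s + t) / 2 with hy
  have hpos : 0 < r * (t - s) := mul_pos hr (by linarith)
  have hφy : 0 < phi c y ^ β := Real.rpow_pos_of_pos (hpos.trans_le h2) β
  have hle : r * (t - s) ≤ phi c x ^ (1 - β) * phi c y ^ β := by
    calc r * (t - s) = (r * (t - s)) ^ (1 - β) * (r * (t - s)) ^ β := by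
          rw [← Real.rpow_add hpos]; simp
      _ ≤ _ := mul_le_mul (Real.rpow_le_rpow hpos.le h1 (by linarith))
        (Real.rpow_le_rpow hpos.le h2 hβ₀) (by positivity) (Real.rpow_nonneg (phi_nonneg c x) _)
  have hmul : (t - s) / phi c y ^ β * phi c y ^ β = t - s := by field_simp
  refine le_csSup ⟨2 * M, ?_⟩ ⟨(t - s) / phi c y ^ β, y, ?_, ?_, ?_, ?_, ?_⟩
  · rintro _ ⟨h, z, -, -, hz1, hz2, rfl⟩
    have := abs_sub (f (z + h * phi c z ^ β / 2)) (f (z - h * phi c z ^ β / 2))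
    linarith [hM _ hz1, hM _ hz2]
  · exact div_nonneg (by linarith) hφy.le
  · rw [div_le_div_iff₀ hφy hr]
    linarith
  · rw [hmul, hy]; convert ht using 1; ring
  · rw [hmul, hy]; convert hs using 1; ring
  · rw [hmul, hy]; congr 3 <;> ring

theorem StepBound.mono_up {c : ℤ} {f : ℝ → ℝ} {x r Λ t : ℝ} (h : StepBound c f x r Λ)
    (hΛ : 0 ≤ Λ) (hr : 0 < r) (hx : 0 < phi c x) (hxt : x ≤ t)
    (hu : ∀ u ∈ Set.Icc x t, u ∈ dom c ∧ phi c x ≤ phi c u) :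
    |f t - f x| ≤ Λ * (1 + r * (t - x) / phi c x) := by
  have := abs_sub_le_of_steps (η := phi c x / r) hxt (by positivity) hΛ fun s hs t ht hst hle => by
    rw [le_div_iff₀ hr, mul_comm] at hle
    exact h s (hu s hs).1 t (hu t ht).1 hst hle
      (hle.trans (hu _ ⟨by linarith [hs.1, ht.1], by linarith [hs.2, ht.2]⟩).2)
  convert this using 3
  field_simp

/-- Below `x` the steps are uniform in `√u`, which adapts them to the behaviour `φ(u) ≳ √u`. -/
theorem StepBound.mono_down {c : ℤ} {f : ℝ → ℝ} {x r Λ t q : ℝ} (h : StepBound c f x r Λ)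
    (hΛ : 0 ≤ Λ) (hr : 0 < r) (ht₀ : 0 ≤ t) (hx : 0 < x) (htx : t ≤ x) (hq : 0 < q)
    (hu : ∀ u ∈ Set.Icc t x, u ∈ dom c ∧ q * √u ≤ phi c u ∧ phi c u ≤ phi c x) :
    |f x - f t| ≤ Λ * (1 + 2 * r * (x - t) / (q * √x)) := by
  have hmem : ∀ v ∈ Set.Icc (√t) (√x), 0 ≤ v ∧ v ^ 2 ∈ Set.Icc t x := fun v hv => by
    have hv0 : 0 ≤ v := (Real.sqrt_nonneg t).trans hv.1
    exact ⟨hv0, (Real.sqrt_le_left hv0).1 hv.1, (Real.le_sqrt hv0 hx.le).1 hv.2⟩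
  have := abs_sub_le_of_steps (g := fun v => f (v ^ 2)) (η := q / (2 * r)) (Real.sqrt_le_sqrt htx)
    (by positivity) hΛ fun s hs t ht hst hle => by
      obtain ⟨hs0, hs⟩ := hmem s hs
      obtain ⟨ht0, ht⟩ := hmem t ht
      rw [le_div_iff₀ (by positivity)] at hle
      have hmid : (s + t) / 2 ≤ √((s ^ 2 + t ^ 2) / 2) :=
        Real.le_sqrt_of_sq_le (by nlinarith [sq_nonneg (s - t)])
      obtain ⟨-, hm1, hm2⟩ := hu ((s ^ 2 + t ^ 2) / 2)
        ⟨by linarith [hs.1, ht.1], by linarith [hs.2, ht.2]⟩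
      have hstep : r * (t ^ 2 - s ^ 2) ≤ phi c ((s ^ 2 + t ^ 2) / 2) := by
        refine le_trans ?_ hm1
        calc r * (t ^ 2 - s ^ 2) = (t - s) * (2 * r) * ((s + t) / 2) := by ring
          _ ≤ q * √((s ^ 2 + t ^ 2) / 2) := by gcongr
      exact h _ (hu _ hs).1 _ (hu _ ht).1 (by gcongr) (hstep.trans hm2) hstep
  simp only [Real.sq_sqrt hx.le, Real.sq_sqrt ht₀] at this
  refine this.trans (mul_le_mul_of_nonneg_left ?_ hΛ)
  have hsx : 0 < √x := Real.sqrt_pos.2 hx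
  have h1 : (√x - √t) * √x ≤ x - t := by
    nlinarith [Real.sqrt_nonneg t, Real.sq_sqrt hx.le, Real.sq_sqrt ht₀, Real.sqrt_le_sqrt htx]
  have h2 : (√x - √t) / (q / (2 * r)) = 2 * r * ((√x - √t) * √x) / (q * √x) := by
    field_simp
  rw [h2]
  gcongr

theorem phi_le_phi_of_nonneg {c : ℤ} (hc : 0 ≤ c) {x u : ℝ} (hx : 0 ≤ x) (hxu : x ≤ u) :
    phi c x ≤ phi c u := by
  have hc' : (0 : ℝ) ≤ c := by exact_mod_cast hc
  have hu : 0 ≤ u := hx.trans hxu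
  unfold phi
  gcongr

/-- On the half-line the number of steps from `x` down to `t` may exceed `r |t - x| / φ(x)` by the
factor `√((1 + c x) / (1 + c t))`, which the last term absorbs. -/
theorem StepBound.deviation_of_nonneg {c : ℤ} (hc : 0 ≤ c) {f : ℝ → ℝ} {x r Λ t : ℝ}
    (h : StepBound c f x r Λ) (hΛ : 0 ≤ Λ) (hr : 0 < r) (hx : 0 < x) (ht : 0 ≤ t) :
    |f t - f x| ≤ Λ * (4 + r ^ 2 * (t - x) ^ 2 / phi c x ^ 2 + (1 + c * x) / (1 + c * t)) := by
  have hc' : (0 : ℝ) ≤ c := by exact_mod_cast hc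
  have hφ : 0 < phi c x := Real.sqrt_pos.2 (by positivity)
  have hdiv : 0 ≤ (1 + c * x) / (1 + c * t) := by positivity
  rcases le_total x t with hxt | htx
  · refine (h.mono_up hΛ hr hφ hxt fun u hu => ⟨?_, phi_le_phi_of_nonneg hc hx.le hu.1⟩).trans ?_
    · rw [dom_of_nonneg hc]; exact hx.le.trans hu.1
    · refine mul_le_mul_of_nonneg_left ?_ hΛ
      have : r ^ 2 * (t - x) ^ 2 / phi c x ^ 2 = (r * (t - x) / phi c x) ^ 2 := by ring
      rw [this]
      nlinarith [sq_nonneg (r * (t - x) / phi c x - 1)]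
  · rw [abs_sub_comm]
    refine (h.mono_down hΛ hr ht hx htx (q := √(1 + c * t)) (by positivity)
      fun u hu => ⟨?_, ?_, phi_le_phi_of_nonneg hc (ht.trans hu.1) hu.2⟩).trans ?_
    · rw [dom_of_nonneg hc]; exact ht.trans hu.1
    · have hu0 := ht.trans hu.1
      rw [phi, Real.sqrt_mul hu0, mul_comm]
      have := hu.1
      gcongr
    · refine mul_le_mul_of_nonneg_left ?_ hΛ
      have e1 : 2 * r * (x - t) / (√(1 + c * t) * √x)
          = 2 * (r * (x - t) / phi c x) * (√(1 + c * x) / √(1 + c * t)) := by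
        rw [phi, Real.sqrt_mul hx.le]
        have : 0 < √(1 + c * x) := by positivity
        field_simp
      have e2 : r ^ 2 * (t - x) ^ 2 / phi c x ^ 2 = (r * (x - t) / phi c x) ^ 2 := by ring
      have e3 : (1 + c * x) / (1 + c * t) = (√(1 + c * x) / √(1 + c * t)) ^ 2 := by
        rw [div_pow, Real.sq_sqrt (by positivity), Real.sq_sqrt (by positivity)]
      rw [e1, e2, e3]
      nlinarith [sq_nonneg (r * (x - t) / phi c x - √(1 + c * x) / √(1 + c * t))]

theorem phi_neg_one_one_sub (x : ℝ) : phi (-1) (1 - x) = phi (-1) x := by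
  unfold phi
  congr 1
  push_cast
  ring

theorem one_sub_mem_dom_neg_one {x : ℝ} (hx : x ∈ dom (-1)) : 1 - x ∈ dom (-1) := by
  rw [dom_neg_one] at *
  exact ⟨by linarith [hx.2], by linarith [hx.1]⟩

theorem StepBound.comp_one_sub {f : ℝ → ℝ} {x y r Λ : ℝ} (h : StepBound (-1) f x r Λ)
    (hy : phi (-1) y = phi (-1) x) : StepBound (-1) (fun u => f (1 - u)) y r Λ := by
  intro s hs t ht hst h1 h2
  rw [abs_sub_comm]
  refine h _ (one_sub_mem_dom_neg_one ht) _ (one_sub_mem_dom_neg_one hs) (by linarith) ?_ ?_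
  · rw [← hy]; linarith
  · rw [show (1 - t + (1 - s)) / 2 = 1 - (s + t) / 2 by ring, phi_neg_one_one_sub]
    linarith

theorem phi_neg_one_le {x u : ℝ} (h₁ : x ≤ u) (h₂ : u ≤ 1 - x) : phi (-1) x ≤ phi (-1) u := by
  unfold phi
  refine Real.sqrt_le_sqrt ?_
  push_cast
  nlinarith [mul_nonneg (sub_nonneg.2 h₁) (sub_nonneg.2 h₂)]

theorem StepBound.mono_down_neg_one {f : ℝ → ℝ} {x r Λ t : ℝ} (h : StepBound (-1) f x r Λ)
    (hΛ : 0 ≤ Λ) (hr : 0 < r) (hx : 0 < x) (hx' : x ≤ 1 / 2) (ht : 0 ≤ t) (htx : t ≤ x) :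
    |f x - f t| ≤ Λ * (1 + 3 * (r * (x - t) / phi (-1) x)) := by
  have hφ : 0 < phi (-1) x := Real.sqrt_pos.2 (mul_pos hx (by push_cast; linarith))
  refine (h.mono_down hΛ hr ht hx htx (q := 2 / 3) (by norm_num)
    fun u hu => ⟨?_, ?_, phi_neg_one_le hu.2 (by linarith [hu.2])⟩).trans ?_
  · rw [dom_neg_one]; exact ⟨ht.trans hu.1, by linarith [hu.2]⟩
  · have hu0 := ht.trans hu.1
    rw [phi, Real.sqrt_mul hu0, mul_comm]
    refine mul_le_mul_of_nonneg_left (Real.le_sqrt_of_sq_le ?_) (Real.sqrt_nonneg u)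
    push_cast
    linarith [hu.2]
  · refine mul_le_mul_of_nonneg_left ?_ hΛ
    have h1 : phi (-1) x ≤ √x := Real.sqrt_le_sqrt (by push_cast; nlinarith)
    have h2 : 2 * r * (x - t) / (2 / 3 * √x) = 3 * (r * (x - t) / √x) := by
      field_simp
    rw [h2]
    have : 0 ≤ r * (x - t) := mul_nonneg hr.le (by linarith)
    gcongr

/-- Beyond `1 - x` the weight is smaller than at `x`; there the chain is the mirror image of one
going down from `x`. -/
theorem StepBound.deviation_of_le_half {f : ℝ → ℝ} {x r Λ t : ℝ} (h : StepBound (-1) f x r Λ)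
    (hΛ : 0 ≤ Λ) (hr : 0 < r) (hx : 0 < x) (hx' : x ≤ 1 / 2) (ht : 0 ≤ t) (ht' : t ≤ 1) :
    |f t - f x| ≤ Λ * (5 + r ^ 2 * (t - x) ^ 2 / phi (-1) x ^ 2) := by
  have hφ : 0 < phi (-1) x := Real.sqrt_pos.2 (mul_pos hx (by push_cast; linarith))
  have up : ∀ t, x ≤ t → t ≤ 1 - x → |f t - f x| ≤ Λ * (1 + r * (t - x) / phi (-1) x) :=
    fun t h1 h2 => h.mono_up hΛ hr hφ h1 fun u hu =>
      ⟨by rw [dom_neg_one]; exact ⟨hx.le.trans hu.1, by linarith [hu.2]⟩,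
        phi_neg_one_le hu.1 (hu.2.trans h2)⟩
  have e : r ^ 2 * (t - x) ^ 2 / phi (-1) x ^ 2 = (r * (t - x) / phi (-1) x) ^ 2 := by ring
  rw [e]
  suffices hs : |f t - f x| ≤ Λ * (2 + 3 * |r * (t - x) / phi (-1) x|) by
    refine hs.trans (mul_le_mul_of_nonneg_left ?_ hΛ)
    rw [← sq_abs (r * (t - x) / phi (-1) x)]
    nlinarith [sq_nonneg (2 * |r * (t - x) / phi (-1) x| - 3)]
  rcases le_total t x with htx | hxt
  · have h1 := h.mono_down_neg_one hΛ hr hx hx' ht htx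
    rw [abs_sub_comm]
    refine h1.trans (mul_le_mul_of_nonneg_left ?_ hΛ)
    have := neg_abs_le (r * (t - x) / phi (-1) x)
    have e' : r * (x - t) / phi (-1) x = -(r * (t - x) / phi (-1) x) := by ring
    linarith
  · rw [abs_of_nonneg (div_nonneg (mul_nonneg hr.le (by linarith)) hφ.le)]
    have hz : 0 ≤ r * (t - x) / phi (-1) x :=
      div_nonneg (mul_nonneg hr.le (by linarith)) hφ.le
    rcases le_total t (1 - x) with h1 | h1
    · exact (up t hxt h1).trans (mul_le_mul_of_nonneg_left (by linarith) hΛ)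
    · have h2 := up (1 - x) (by linarith) le_rfl
      have h3 := (h.comp_one_sub (y := x) rfl).mono_down_neg_one hΛ hr hx hx'
        (t := 1 - t) (by linarith) (by linarith)
      simp only [sub_sub_cancel] at h3
      rw [abs_sub_comm] at h3
      refine (abs_sub_le _ (f (1 - x)) _).trans ((add_le_add h3 h2).trans ?_)
      rw [← mul_add]
      refine mul_le_mul_of_nonneg_left ?_ hΛ
      have e' : r * (t - x) / phi (-1) x
          = r * (x - (1 - t)) / phi (-1) x + r * (1 - x - x) / phi (-1) x := by ring
      have hz' : 0 ≤ r * (1 - x - x) / phi (-1) x :=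
        div_nonneg (mul_nonneg hr.le (by linarith)) hφ.le
      linarith

theorem StepBound.deviation_neg_one {f : ℝ → ℝ} {x r Λ t : ℝ} (h : StepBound (-1) f x r Λ)
    (hΛ : 0 ≤ Λ) (hr : 0 < r) (hx : 0 < x) (hx' : x < 1) (ht : 0 ≤ t) (ht' : t ≤ 1) :
    |f t - f x| ≤ Λ * (5 + r ^ 2 * (t - x) ^ 2 / phi (-1) x ^ 2) := by
  rcases le_total x (1 / 2) with h1 | h1
  · exact h.deviation_of_le_half hΛ hr hx h1 ht ht'
  · have := (h.comp_one_sub (phi_neg_one_one_sub x)).deviation_of_le_half hΛ hr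
      (by linarith) (by linarith) (t := 1 - t) (by linarith) (by linarith)
    simp only [sub_sub_cancel, phi_neg_one_one_sub] at this
    convert this using 5
    ring

/-! ### Moments of the Durrmeyer kernels -/

theorem rise_nonneg_of_intCast {c : ℤ} (hc : -1 ≤ c) {a : ℤ} (ha : 0 ≤ a) {ν : ℝ}
    (hν : (a : ℝ) = ν) (k : ℕ) : 0 ≤ rise ν c k := by
  lift a to ℕ using ha
  rw [← hν]
  exact_mod_cast rise_natCast_nonneg hc a k

theorem measurableSet_dom (c : ℤ) : MeasurableSet (dom c) :=
  (measurableSet_le measurable_const measurable_id).inter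
    (measurableSet_le measurable_const ((measurable_id.const_mul (c : ℝ)).const_add 1))

/-- Only the point `1` for `c = -1` lies in the domain without satisfying `1 + c t > 0`. -/
theorem ae_dom (c : ℤ) : ∀ᵐ t ∂MeasureTheory.volume.restrict (dom c),
    t ∈ dom c ∧ 0 < 1 + (c : ℝ) * t := by
  have h1 : ∀ᵐ t ∂MeasureTheory.volume.restrict (dom c), t ≠ -(c : ℝ)⁻¹ :=
    MeasureTheory.ae_restrict_of_ae (by simp [MeasureTheory.ae_iff])
  filter_upwards [h1, MeasureTheory.ae_restrict_mem (measurableSet_dom c)] with t ht ht'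
  refine ⟨ht', ht'.2.lt_of_ne fun h => ht ?_⟩
  have hc : (c : ℝ) ≠ 0 := by rintro h0; simp [h0] at h
  field_simp
  linarith

/-- The condition on `k` for `c = -1` excludes the identically vanishing basis functions. -/
theorem integral_bas {c : ℤ} (hc : -1 ≤ c) {a : ℤ} {ν : ℝ} (hν : (a : ℝ) = ν)
    (ha : 0 < a - 2 * c) {k : ℕ} (hk : c = -1 → (k : ℤ) ≤ a) :
    MeasureTheory.IntegrableOn (bas ν c k) (dom c) ∧ ∫ t in dom c, bas ν c k t = 1 / (ν - c) := by
  rcases hc.eq_or_lt with rfl | hc'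
  · have hk' : (k : ℝ) < ν + 1 := by
      rw [← hν]; exact_mod_cast (by have := hk rfl; omega : (k : ℤ) < a + 1)
    have := integral_bas_neg_one (ν := ν + 1) (rise_nonneg_of_intCast (a := a + 1) le_rfl
      (by have := hk rfl; omega) (by push_cast; linarith)) hk'
    rwa [show ν + 1 + ((-1 : ℤ) : ℝ) = ν by push_cast; ring,
      show ν + 1 = ν - ((-1 : ℤ) : ℝ) by push_cast; ring] at this
  · have := integral_bas_of_nonneg (ν := ν - 2 * c) (c := c) (by omega)
      (by rw [← hν]; exact_mod_cast ha)
      (rise_nonneg_of_intCast (a := a - 2 * c) hc ha.le (by push_cast; linarith)) k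
    rwa [show ν - 2 * c + c + c = ν by ring, show ν - 2 * c + c = ν - c by ring] at this

/-- The value at the index `k` of the Durrmeyer functional with parameter `ν` on the test function
`a + b (t - x)² + e / (1 + c t)`. -/
noncomputable def testMoment (ν : ℝ) (c : ℤ) (a b e x : ℝ) (k : ℕ) : ℝ :=
  a + b * (k * (k + 1) / (ν * (ν - c)) - 2 * x * (k / ν) + x ^ 2) +
    e * ((ν + c) / (ν + (k + 1) * c))

/-- For `c = -1` the first condition is the stronger one, for `c ≥ 0` the second. -/
theorem cast_bounds {c : ℤ} (hc : -1 ≤ c) {N : ℕ} (hN : 5 ≤ N) (hcN : 3 * c + 5 ≤ N) :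
    (0 : ℝ) < N ∧ (0 : ℝ) < N + c ∧ (0 : ℝ) < N - c ∧ (0 : ℝ) < N + 2 * c := by
  refine ⟨?_, ?_, ?_, ?_⟩
  · exact_mod_cast (by omega : 0 < N)
  · exact_mod_cast (by omega : (0 : ℤ) < N + c)
  · exact_mod_cast (by omega : (0 : ℤ) < N - c)
  · exact_mod_cast (by omega : (0 : ℤ) < N + 2 * c)

theorem integral_bas_mul_test {c : ℤ} (hc : -1 ≤ c) {N : ℕ} (hN : 5 ≤ N) (hcN : 3 * c + 5 ≤ N)
    {k : ℕ} (hk : c = -1 → k + 2 ≤ N) (a b : ℝ) {e : ℝ} (he : e = 0 ∨ 0 ≤ c) (x : ℝ) :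
    MeasureTheory.IntegrableOn (fun t => bas (N + 2 * c) c k t *
      (a + b * (t - x) ^ 2 + e / (1 + c * t))) (dom c) ∧
    (N + c) * ∫ t in dom c, bas (N + 2 * c) c k t * (a + b * (t - x) ^ 2 + e / (1 + c * t)) =
      testMoment N c a b e x (k + 1) := by
  obtain ⟨h0, h1, h2, h3⟩ := cast_bounds hc hN hcN
  obtain ⟨i0, v0⟩ := integral_bas hc (a := N + 2 * c) (ν := N + 2 * c) (k := k)
    (by push_cast; ring) (by omega) (by intro h; have := hk h; omega)
  obtain ⟨i1, v1⟩ := integral_bas hc (a := N + c) (ν := N + c) (k := k + 1)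
    (by push_cast; ring) (by omega) (by intro h; have := hk h; omega)
  obtain ⟨i2, v2⟩ := integral_bas hc (a := N) (ν := N) (k := k + 2)
    (by push_cast; ring) (by omega) (by intro h; have := hk h; omega)
  -- The third kernel only enters when `e ≠ 0`, and then `c ≥ 0`.
  obtain ⟨i3, v3⟩ : MeasureTheory.IntegrableOn (fun t => e * bas (N + 3 * c) c k t) (dom c) ∧
      ∫ t in dom c, e * bas (N + 3 * c) c k t = e * (1 / (N + 2 * c)) := by
    rcases he with rfl | he
    · simp
    · obtain ⟨i3, v3⟩ := integral_bas hc (a := N + 3 * c) (ν := N + 3 * c) (k := k)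
        (by push_cast; ring) (by omega) (by omega)
      refine ⟨i3.const_mul e, ?_⟩
      rw [MeasureTheory.integral_const_mul, v3]
      congr 2; ring
  have hden : e = 0 ∨ (0 : ℝ) < N + 2 * c + k * c := by
    refine he.imp_right fun he => ?_
    have : (0 : ℝ) ≤ c := by exact_mod_cast he
    positivity
  have hae : (fun t => bas (N + 2 * c) c k t * (a + b * (t - x) ^ 2 + e / (1 + c * t)))
      =ᵐ[MeasureTheory.volume.restrict (dom c)] fun t =>
        ((a + b * x ^ 2) * bas (N + 2 * c) c k t
          + (-(2 * b * x * ((k + 1) / (N + c)))) * bas (N + c) c (k + 1) t)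
        + (b * ((k + 1) * (k + 2) / ((N + c) * N))) * bas N c (k + 2) t
        + ((N + 2 * c) / (N + 2 * c + k * c)) * (e * bas (N + 3 * c) c k t) := by
    filter_upwards [ae_dom c] with t ht
    have e1 := mul_bas_add (N + c) c k t
    have e2 := mul_bas_add N c (k + 1) t
    have e3 := one_add_mul_bas_add (N + 2 * c) k ht.2
    rw [show (N : ℝ) + c + c = N + 2 * c by ring] at e1
    rw [show (N : ℝ) + 2 * c + c = N + 3 * c by ring] at e3
    have f1 : t * bas (N + 2 * c) c k t = (k + 1) / (N + c) * bas (N + c) c (k + 1) t := by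
      field_simp; linarith
    have f2 : t * bas (N + c) c (k + 1) t = (k + 2) / N * bas N c (k + 2) t := by
      field_simp
      push_cast at e2
      linear_combination e2
    have f3 : bas (N + 2 * c) c k t * (e / (1 + c * t)) =
        ((N + 2 * c) / (N + 2 * c + k * c)) * (e * bas (N + 3 * c) c k t) := by
      rcases hden with rfl | hden
      · simp
      · have := ht.2
        rw [div_mul_eq_mul_div, mul_div_assoc', div_eq_div_iff this.ne' hden.ne']
        linear_combination (-e) * e3
    have f4 : (k + 1) * (k + 2) / ((N + c) * N) * bas N c (k + 2) t =
        t * (t * bas (N + 2 * c) c k t) := by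
      rw [f1, mul_left_comm, f2]
      field_simp
    rw [mul_add, f3, mul_assoc b, f4]
    linear_combination (-(2 * b * x)) * f1
  have j0 := i0.const_mul (a + b * x ^ 2)
  have j1 := i1.const_mul (-(2 * b * x * ((k + 1) / (N + c))))
  have j2 := i2.const_mul (b * ((k + 1) * (k + 2) / ((N + c) * N)))
  have j3 := i3.const_mul (((N : ℝ) + 2 * c) / (N + 2 * c + k * c))
  refine ⟨(((j0.fun_add j1).fun_add j2).fun_add j3).congr hae.symm, ?_⟩
  rw [MeasureTheory.integral_congr_ae hae, MeasureTheory.integral_add ((j0.fun_add j1).fun_add j2) j3,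
    MeasureTheory.integral_add (j0.fun_add j1) j2, MeasureTheory.integral_add j0 j1]
  simp only [MeasureTheory.integral_const_mul (_ : ℝ) (bas _ _ _)]
  rw [MeasureTheory.integral_const_mul, v0, v1, v2, v3, testMoment]
  rw [show (N : ℝ) + 2 * c - c = N + c by ring, show (N : ℝ) + c - c = N by ring]
  rw [show (N : ℝ) + ((k + 1 : ℕ) + 1) * c = N + 2 * c + k * c by push_cast; ring]
  push_cast
  generalize (N : ℝ) + 2 * c + k * c = D at hden ⊢
  generalize (N : ℝ) + 2 * c = E at h3 ⊢
  rcases hden with rfl | hden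
  · field_simp
    ring
  · field_simp
    ring

/-! ### The operator as a weighted sum of functionals -/

/-- The functional that the operator with parameter `ν = N` pairs with the weight of index `k`: the
value `f 0` for `k = 0`, the normalized integral against a basis function for `k ≥ 1`, and for
`c = -1` the value `f 1` at the last index `k = N`, where the integral vanishes. -/
noncomputable def node (N : ℕ) (c : ℤ) (f : ℝ → ℝ) (k : ℕ) : ℝ :=
  (if k = 0 then f 0 else (N + c) * ∫ t in dom c, p (N + 2 * c) c (k - 1) t * f t) +
    if c = -1 ∧ k = N then f 1 else 0

theorem setIntegral_p_mul_eq_zero {N : ℕ} (hN : 2 ≤ N) {k : ℕ} (hk : N ≤ k + 1) (f : ℝ → ℝ) :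
    ∫ t in dom (-1), p (N + 2 * (-1 : ℤ)) (-1) k t * f t = 0 := by
  refine MeasureTheory.integral_eq_zero_of_ae ?_
  filter_upwards [ae_dom (-1)] with t ht
  have h : rise (N + 2 * (-1 : ℤ)) (-1) k = 0 := by
    have := rise_natCast_eq_zero (N := N - 2) (k := k) (by omega)
    rw [Nat.cast_sub hN] at this
    rw [← this]
    congr 1
    push_cast
    ring
  rw [p_eq_bas _ _ ht.2, bas, h]
  simp

/-- The node functionals are positive and reproduce constants, so the bound on `|f - y|` passes
through them. -/
theorem abs_node_sub_le {c : ℤ} (hc : -1 ≤ c) {N : ℕ} (hN : 5 ≤ N) (hcN : 3 * c + 5 ≤ N)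
    {f : ℝ → ℝ} (hf : ContinuousOn f (dom c)) {a b e x y : ℝ} (he : e = 0 ∨ 0 ≤ c)
    (hfy : ∀ t ∈ dom c, |f t - y| ≤ a + b * (t - x) ^ 2 + e / (1 + c * t))
    {k : ℕ} (hk : c = -1 → k ≤ N) :
    |node N c f k - y| ≤ testMoment N c a b e x k := by
  obtain ⟨h0, h1, h2, h3⟩ := cast_bounds hc hN hcN
  rcases Nat.eq_zero_or_pos k with rfl | hkpos
  · have hN0 : ¬ (c = -1 ∧ 0 = N) := by omega
    have := hfy 0 (by simp [dom])
    simp only [node, testMoment, if_true, hN0, if_false, add_zero]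
    have e1 : ((N : ℝ) + c) / (N + (((0 : ℕ) : ℝ) + 1) * c) = 1 := by
      rw [Nat.cast_zero, zero_add, one_mul, div_self h1.ne']
    rw [e1]
    convert this using 1
    simp
  obtain ⟨k, rfl⟩ : ∃ j, k = j + 1 := ⟨k - 1, by omega⟩
  by_cases hlast : c = -1 ∧ k + 1 = N
  · obtain ⟨rfl, rfl⟩ := hlast
    have he0 : e = 0 := by rcases he with h | h <;> [exact h; omega]
    subst he0
    have := hfy 1 (by simp [dom])
    have hz := setIntegral_p_mul_eq_zero (N := k + 1) (k := k) (by omega) le_rfl f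
    simp only [node, testMoment, Nat.add_sub_cancel, hz]
    simp only [Nat.add_eq_zero_iff, one_ne_zero, and_false, if_false, mul_zero, zero_add, true_and,
      if_true]
    convert this using 1
    push_cast at *
    field_simp
    ring
  · obtain ⟨iG, vG⟩ := integral_bas_mul_test hc hN hcN (k := k)
      (by intro h; have := hk h; omega) a b he x
    obtain ⟨i0, v0⟩ := integral_bas hc (a := N + 2 * c) (ν := N + 2 * c) (k := k)
      (by push_cast; ring) (by omega) (by intro h; have := hk h; omega)
    have hpos : ∀ t ∈ dom c, 0 < 1 + (c : ℝ) * t → 0 ≤ bas (N + 2 * c) c k t := fun t ht ht' =>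
      bas_nonneg (rise_nonneg_of_intCast hc (a := N + 2 * c) (by omega) (by push_cast; ring) k)
        ht.1 ht'
    have hbound : ∀ᵐ t ∂MeasureTheory.volume.restrict (dom c),
        ‖bas (N + 2 * c) c k t * (f t - y)‖ ≤
          bas (N + 2 * c) c k t * (a + b * (t - x) ^ 2 + e / (1 + c * t)) := by
      filter_upwards [ae_dom c] with t ht
      rw [norm_mul, Real.norm_of_nonneg (hpos t ht.1 ht.2), Real.norm_eq_abs]
      exact mul_le_mul_of_nonneg_left (hfy t ht.1) (hpos t ht.1 ht.2)
    have iD : MeasureTheory.IntegrableOn (fun t => bas (N + 2 * c) c k t * (f t - y)) (dom c) :=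
      iG.mono' (i0.aestronglyMeasurable.mul
        ((hf.sub continuousOn_const).aestronglyMeasurable (measurableSet_dom c))) hbound
    have hsplit : ∫ t in dom c, p (N + 2 * c) c k t * f t =
        (∫ t in dom c, bas (N + 2 * c) c k t * (f t - y)) + 1 / (N + c) * y := by
      have : (fun t => p (N + 2 * c) c k t * f t) =ᵐ[MeasureTheory.volume.restrict (dom c)]
          fun t => bas (N + 2 * c) c k t * (f t - y) + bas (N + 2 * c) c k t * y := by
        filter_upwards [ae_dom c] with t ht
        rw [p_eq_bas _ _ ht.2]
        ring
      rw [MeasureTheory.integral_congr_ae this, MeasureTheory.integral_add iD (i0.mul_const y),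
        MeasureTheory.integral_mul_const, v0]
      congr 3
      ring
    have hmain := mul_le_mul_of_nonneg_left
      (MeasureTheory.norm_integral_le_of_norm_le iG hbound) h1.le
    rw [vG, Real.norm_eq_abs] at hmain
    simp only [node, hlast, if_false, add_zero, Nat.add_sub_cancel, hsplit, Nat.add_eq_zero_iff,
      one_ne_zero, and_false]
    have e1 : ((N : ℝ) + c) * ((∫ t in dom c, bas (N + 2 * c) c k t * (f t - y)) + 1 / (N + c) * y)
        - y = (N + c) * ∫ t in dom c, bas (N + 2 * c) c k t * (f t - y) := by
      field_simp
      ring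
    rw [e1, abs_mul, abs_of_pos h1]
    exact hmain

/-! ### The Bézier weights -/

theorem rpow_sub_rpow_le {α u v : ℝ} (hα : 1 ≤ α) (hv : 0 ≤ v) (hvu : v ≤ u) (hu : u ≤ 1) :
    u ^ α - v ^ α ≤ α * (u - v) := by
  rcases (hv.trans hvu).eq_or_lt with h0 | h0
  · have : v = 0 := le_antisymm (by linarith) hv
    simp [← h0, this]
  · have h1 := one_add_mul_self_le_rpow_one_add (s := v / u - 1)
      (by linarith [div_nonneg hv h0.le]) hα
    rw [add_sub_cancel, Real.div_rpow hv h0.le, le_div_iff₀ (by positivity)] at h1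
    have h2 : u ^ α ≤ u := Real.rpow_le_self_of_le_one h0.le hu hα
    have h3 : 0 ≤ 1 - v / u := sub_nonneg.2 ((div_le_one h0).2 hvu)
    calc u ^ α - v ^ α ≤ α * (1 - v / u) * u ^ α := by linarith
      _ ≤ α * (1 - v / u) * u := by gcongr
      _ = α * (u - v) := by field_simp

theorem hasSum_p {c : ℤ} (hc : -1 ≤ c) {N : ℕ} (hN : 5 ≤ N) {x : ℝ} (hx₀ : 0 ≤ x)
    (hx : 0 < 1 + (c : ℝ) * x) : HasSum (fun k => p N c k x) 1 := by
  simp_rw [p_eq_bas _ _ hx]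
  refine hasSum_bas (rise_natCast_nonneg hc N) ?_ ?_ hx₀ hx
  · exact_mod_cast (by omega : 0 < N)
  · exact_mod_cast (by omega : (0 : ℤ) < N + c)

theorem J_eq_one_sub {ν : ℝ} {c : ℤ} {x : ℝ} (h : HasSum (fun k => p ν c k x) 1) (k : ℕ) :
    J ν c k x = 1 - ∑ i ∈ Finset.range k, p ν c i x := by
  have := h.summable.sum_add_tsum_nat_add k
  rw [h.tsum_eq] at this
  simp only [J, add_comm k]
  linarith

/-- The Bézier weights form a probability distribution dominated by `α` times the basis. -/
theorem Q_bounds_and_hasSum {α ν : ℝ} {c : ℤ} {x : ℝ} (hα : 1 ≤ α)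
    (hp : ∀ k, 0 ≤ p ν c k x) (h : HasSum (fun k => p ν c k x) 1) :
    (∀ k, 0 ≤ Q α ν c k x ∧ Q α ν c k x ≤ α * p ν c k x) ∧
      HasSum (fun k => Q α ν c k x) 1 := by
  have hα0 : 0 < α := by linarith
  have hJ := J_eq_one_sub h
  have hJ0 : ∀ k, 0 ≤ J ν c k x := fun k => tsum_nonneg fun j => hp _
  have hJ1 : ∀ k, J ν c k x ≤ 1 := fun k => by
    rw [hJ]; linarith [Finset.sum_nonneg fun i (_ : i ∈ Finset.range k) => hp i]
  have hJs : ∀ k, J ν c k x - J ν c (k + 1) x = p ν c k x := fun k => by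
    rw [hJ, hJ, Finset.sum_range_succ]; ring
  have hQ : ∀ k, 0 ≤ Q α ν c k x := fun k =>
    sub_nonneg.2 (Real.rpow_le_rpow (hJ0 _) (by linarith [hJs k, hp k]) hα0.le)
  refine ⟨fun k => ⟨hQ k, ?_⟩, ?_⟩
  · rw [← hJs k]
    exact rpow_sub_rpow_le hα (hJ0 _) (by linarith [hJs k, hp k]) (hJ1 k)
  · rw [hasSum_iff_tendsto_nat_of_nonneg hQ]
    have hsum : ∀ n, ∑ k ∈ Finset.range n, Q α ν c k x = 1 - J ν c n x ^ α := fun n => by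
      simp only [Q, Finset.sum_range_sub' (fun k => J ν c k x ^ α)]
      rw [hJ 0]
      simp
    have hlim : Tendsto (fun n => J ν c n x) atTop (nhds 0) := by
      simp_rw [hJ]
      simpa using h.tendsto_sum_nat.const_sub 1
    simp_rw [hsum]
    simpa [Real.zero_rpow hα0.ne'] using
      ((Real.continuousAt_rpow_const 0 α (Or.inr hα0.le)).tendsto.comp hlim).const_sub 1

/-- The operator with `α = 1` preserves linear functions, has second central moment
`2 φ(x)² / (N - c)`, and maps `1 / (1 + c t)` to at most a constant times `1 / (1 + c x)`. The
summable majorant `D` differs from the weighted moments only in the reciprocal term. -/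
theorem hasSum_testMoment_mul_bas {c : ℤ} (hc : -1 ≤ c) {N : ℕ} (hN : 5 ≤ N)
    (hcN : 3 * c + 5 ≤ N) {x : ℝ} (hx₀ : 0 ≤ x) (hx : 0 < 1 + (c : ℝ) * x) (a b : ℝ) {e : ℝ}
    (he₀ : 0 ≤ e) (he : e = 0 ∨ 0 ≤ c) :
    ∃ D : ℕ → ℝ, (∀ k, bas N c k x * testMoment N c a b e x k ≤ D k) ∧
      HasSum D (a + b * (2 * phi c x ^ 2 / (N - c)) +
        e * ((N + c) / ((N - c) * (1 + c * x)))) := by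
  obtain ⟨h0, h1, h2, h3⟩ := cast_bounds hc hN hcN
  have s0 := hasSum_bas (rise_natCast_nonneg hc N) h0 h1 hx₀ hx
  have s1 : HasSum (fun k : ℕ => k * bas N c k x) (N * x) := by
    have s := (hasSum_bas (rise_add_nonneg h0 (rise_natCast_nonneg hc N)) h1
      (by linarith) hx₀ hx).mul_left (N * x)
    have hfun : (fun k : ℕ => ((k + 1 : ℕ) : ℝ) * bas N c (k + 1) x) =
        fun k => N * x * bas (N + c) c k x := by
      ext k
      push_cast
      linear_combination -mul_bas_add N c k x
    rw [← hfun] at s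
    simpa using (hasSum_nat_add_iff (f := fun k : ℕ => (k : ℝ) * bas N c k x) 1).1 s
  have s2 : HasSum (fun k : ℕ => (k * (k - 1)) * bas N c k x) (N * (N + c) * x ^ 2) := by
    have s := (hasSum_bas (ν := N + 2 * c) (c := c)
      (rise_nonneg_of_intCast hc (a := N + 2 * c) (by omega) (by push_cast; ring)) h3
      (by have : (0 : ℤ) < N + 2 * c + c := by omega
          exact_mod_cast this) hx₀ hx).mul_left (N * (N + c) * x ^ 2)
    have hfun : (fun k : ℕ => (((k + 2 : ℕ) : ℝ) * ((k + 2 : ℕ) - 1)) * bas N c (k + 2) x) =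
        fun k => N * (N + c) * x ^ 2 * bas (N + 2 * c) c k x := by
      ext k
      have e1 := mul_bas_add N c (k + 1) x
      have e2 := mul_bas_add (N + c) c k x
      rw [show (N : ℝ) + c + c = N + 2 * c by ring] at e2
      push_cast at *
      linear_combination (-(k + 1) : ℝ) * e1 - N * x * e2
    rw [← hfun] at s
    simpa [Finset.sum_range_succ] using
      (hasSum_nat_add_iff (f := fun k : ℕ => ((k : ℝ) * (k - 1)) * bas N c k x) 2).1 s
  have s3 := hasSum_bas (ν := N - c) (c := c)
    (rise_nonneg_of_intCast hc (a := N - c) (by omega) (by push_cast; ring)) h2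
    (by simpa using h0) hx₀ hx
  refine ⟨fun k => (a + b * x ^ 2) * bas N c k x
    + b * ((1 / (N * (N - c))) * ((k * (k - 1)) * bas N c k x)
      + (2 / (N * (N - c)) - 2 * x / N) * (k * bas N c k x))
    + e * ((N + c) / ((N - c) * (1 + c * x))) * bas (N - c) c k x, fun k => ?_, ?_⟩
  · have hthird : bas N c k x * (e * ((N + c) / (N + (k + 1) * c))) ≤
        e * ((N + c) / ((N - c) * (1 + c * x))) * bas (N - c) c k x := by
      rcases he with rfl | hc0
      · simp
      · have hc' : (0 : ℝ) ≤ c := by exact_mod_cast hc0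
        have e1 := one_add_mul_bas_add (N - c) k hx
        rw [sub_add_cancel] at e1
        have hb := bas_nonneg (rise_nonneg_of_intCast hc (a := N - c) (by omega)
          (by push_cast; ring) k) hx₀ hx (ν := N - c)
        have hden : (0 : ℝ) < N + (k + 1) * c := by positivity
        have e2 : bas N c k x =
            (N - c + k * c) * bas (N - c) c k x / ((N - c) * (1 + c * x)) := by
          rw [← e1]; field_simp
        rw [e2]
        have e3 : (N - c + k * c) * bas (N - c) c k x / ((N - c) * (1 + c * x)) *
            (e * ((N + c) / (N + (k + 1) * c))) =
            e * ((N + c) / ((N - c) * (1 + c * x))) * bas (N - c) c k x *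
              ((N - c + k * c) / (N + (k + 1) * c)) := by
          ring
        rw [e3]
        refine mul_le_of_le_one_right (by positivity) ((div_le_one hden).2 ?_)
        linarith
    have hrest : bas N c k x * (a + b * (k * (k + 1) / (N * (N - c)) - 2 * x * (k / N) + x ^ 2)) =
        (a + b * x ^ 2) * bas N c k x
        + b * ((1 / (N * (N - c))) * ((k * (k - 1)) * bas N c k x)
          + (2 / (N * (N - c)) - 2 * x / N) * (k * bas N c k x)) := by
      ring
    rw [testMoment, mul_add, hrest]
    linarith
  · have t12 := ((s2.mul_left (1 / (N * (N - c) : ℝ))).add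
      (s1.mul_left (2 / (N * (N - c)) - 2 * x / N))).mul_left b
    have t := ((s0.mul_left (a + b * x ^ 2)).add t12).add
      (s3.mul_left (e * ((N + c) / ((N - c) * (1 + c * x)))))
    have hval : a + b * (2 * phi c x ^ 2 / (N - c)) + e * ((N + c) / ((N - c) * (1 + c * x))) =
        (a + b * x ^ 2) * 1 + b * (1 / (N * (N - c)) * (N * (N + c) * x ^ 2) +
          (2 / (N * (N - c)) - 2 * x / N) * (N * x)) +
          e * ((N + c) / ((N - c) * (1 + c * x))) * 1 := by
      rw [phi, Real.sq_sqrt (mul_nonneg hx₀ hx.le)]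
      field_simp
      ring
    rw [hval]
    exact t

/-! ### The operator as a weighted mean -/

/-- The operator written with the single natural parameter `N = n + m c`. -/
theorem F_eq {n N : ℕ} {m c : ℤ} (hN : (N : ℤ) = n + m * c) (α : ℝ) (f : ℝ → ℝ) (x : ℝ) :
    F n m c α f x = (N + c) * (∑' k : ℕ, Q α N c (k + 1) x *
        (∫ t in dom c, p (N + 2 * c) c k t * f t)) + Q α N c 0 x * f 0 +
      (if c = -1 then Q α N c N x * f 1 else 0) := by
  have hN' : (N : ℝ) = n + m * c := by exact_mod_cast hN
  have h1 : c = -1 → ((n : ℤ) - m).toNat = N := by rintro rfl; omega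
  rw [F, show (n : ℝ) + (m + 1) * c = N + c by rw [hN']; ring, ← hN',
    show (n : ℝ) + (m + 2) * c = N + 2 * c by rw [hN']; ring]
  congr 1
  split_ifs with h
  · rw [h1 h]
  · rfl

theorem F_eq_of_hasSum {n N : ℕ} {m c : ℤ} (hN : (N : ℤ) = n + m * c) {α : ℝ}
    {f : ℝ → ℝ} {x S : ℝ}
    (h : HasSum (fun k => Q α N c k x * node N c f k) S) : F n m c α f x = S := by
  have hE : HasSum (fun k => Q α N c k x * if c = -1 ∧ k = N then f 1 else 0)
      (if c = -1 then Q α N c N x * f 1 else 0) := by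
    convert hasSum_single N (fun k hk => ?_) using 1
    · split_ifs <;> simp_all
    · simp [hk]
  have hA := (hasSum_nat_add_iff' 1).2 (h.sub hE)
  have hfun : (fun k => (N + c) * (Q α N c (k + 1) x *
      (∫ t in dom c, p (N + 2 * c) c k t * f t))) =
      fun k => Q α N c (k + 1) x * node N c f (k + 1) -
        Q α N c (k + 1) x * if c = -1 ∧ k + 1 = N then f 1 else 0 := by
    ext k
    simp only [node, Nat.add_sub_cancel, Nat.add_eq_zero_iff, one_ne_zero, and_false, if_false]
    ring
  have hA' : ∑' k, (N + c) * (Q α N c (k + 1) x *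
      (∫ t in dom c, p (N + 2 * c) c k t * f t)) =
      S - (if c = -1 then Q α N c N x * f 1 else 0) - Q α N c 0 x * f 0 := by
    rw [hfun, hA.tsum_eq]
    simp only [node, Finset.sum_range_one, if_true]
    ring
  rw [F_eq hN, ← tsum_mul_left, hA']
  ring

theorem abs_F_sub_le {n N : ℕ} {m c : ℤ} (hN : (N : ℤ) = n + m * c) (hc : -1 ≤ c)
    (hN5 : 5 ≤ N) (hcN : 3 * c + 5 ≤ N) {α : ℝ} (hα : 1 ≤ α) {f : ℝ → ℝ}
    (hf : ContinuousOn f (dom c)) {x y : ℝ} (hx₀ : 0 ≤ x) (hx : 0 < 1 + (c : ℝ) * x)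
    {a b e : ℝ} (he₀ : 0 ≤ e) (he : e = 0 ∨ 0 ≤ c)
    (hfy : ∀ t ∈ dom c, |f t - y| ≤ a + b * (t - x) ^ 2 + e / (1 + c * t)) :
    |F n m c α f x - y| ≤ α * (a + b * (2 * phi c x ^ 2 / (N - c)) +
        e * ((N + c) / ((N - c) * (1 + c * x)))) := by
  obtain ⟨D, hD, hDsum⟩ := hasSum_testMoment_mul_bas hc hN5 hcN hx₀ hx a b he₀ he
  have hp : ∀ k, 0 ≤ p N c k x := fun k => by
    rw [p_eq_bas _ _ hx]; exact bas_nonneg (rise_natCast_nonneg hc N k) hx₀ hx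
  obtain ⟨hQ, hQsum⟩ := Q_bounds_and_hasSum hα hp (hasSum_p hc hN5 hx₀ hx)
  have hbound : ∀ k, ‖Q α N c k x * (node N c f k - y)‖ ≤ α * D k := by
    intro k
    rw [norm_mul, Real.norm_of_nonneg (hQ k).1, Real.norm_eq_abs]
    have hDk : p N c k x * testMoment N c a b e x k ≤ D k := by
      rw [p_eq_bas _ _ hx]; exact hD k
    by_cases hk : c = -1 → k ≤ N
    · calc _ ≤ α * p N c k x * testMoment N c a b e x k := by
            have := abs_node_sub_le hc hN5 hcN hf he hfy hk
            exact mul_le_mul (hQ k).2 this (abs_nonneg _) ((hQ k).1.trans (hQ k).2)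
        _ ≤ α * D k := by
            rw [mul_assoc]
            exact mul_le_mul_of_nonneg_left hDk (by linarith)
    · -- Beyond the index `N` all weights vanish when `c = -1`.
      push Not at hk
      obtain ⟨rfl, hk⟩ := hk
      have hp0 : p N (-1) k x = 0 := by
        rw [p_eq_bas _ _ hx, bas, rise_natCast_eq_zero hk]; simp
      have hQ0 : Q α N (-1) k x = 0 := le_antisymm (by simpa [hp0] using (hQ k).2) (hQ k).1
      rw [hp0, zero_mul] at hDk
      rw [hQ0, zero_mul]
      exact mul_nonneg (by linarith) hDk
  have hDα := hDsum.mul_left α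
  have hsum : Summable (fun k => Q α N c k x * (node N c f k - y)) :=
    Summable.of_norm_bounded hDα.summable hbound
  have hF : F n m c α f x = ∑' k, Q α N c k x * (node N c f k - y) + 1 * y := by
    refine F_eq_of_hasSum hN ?_
    refine (hsum.hasSum.add (hQsum.mul_right y)).congr_fun ?_
    intro k
    ring
  rw [hF, one_mul, add_sub_cancel_right, ← Real.norm_eq_abs]
  exact tsum_of_norm_bounded hDα hbound

/-! ### Interpolation at the endpoints -/

theorem Q_of_point_mass {α ν : ℝ} {c : ℤ} {x : ℝ} {k₀ : ℕ} (hα : 0 < α)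
    (h : ∀ k, p ν c k x = if k = k₀ then 1 else 0) (k : ℕ) :
    Q α ν c k x = if k = k₀ then 1 else 0 := by
  have hs : HasSum (fun k => p ν c k x) 1 := by
    simp_rw [h]; exact hasSum_ite_eq k₀ 1
  have hJ : ∀ k, J ν c k x = if k ≤ k₀ then 1 else 0 := fun k => by
    rw [J_eq_one_sub hs]
    simp_rw [h]
    rw [Finset.sum_ite_eq']
    by_cases hk : k ≤ k₀
    · simp [hk, not_lt.2 hk]
    · simp [hk, not_le.1 hk]
  rw [Q, hJ, hJ]
  rcases lt_trichotomy k k₀ with hk | rfl | hk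
  · simp [hk.le, Nat.succ_le_of_lt hk, hk.ne]
  · simp [Real.zero_rpow hα.ne']
  · simp [not_le.2 hk, hk.ne', show ¬ k + 1 ≤ k₀ by omega]

theorem F_of_point_mass {n N : ℕ} {m c : ℤ} (hN : (N : ℤ) = n + m * c)
    {α : ℝ} (hα : 0 < α) (f : ℝ → ℝ) {x : ℝ} {k₀ : ℕ}
    (h : ∀ k, p N c k x = if k = k₀ then 1 else 0) :
    F n m c α f x = node N c f k₀ := by
  refine F_eq_of_hasSum hN ?_
  simp_rw [Q_of_point_mass hα h]
  convert hasSum_single k₀ (fun k hk => ?_) using 1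
  · simp
  · simp [hk]

theorem p_apply_zero (ν : ℝ) (c : ℤ) (k : ℕ) : p ν c k 0 = if k = 0 then 1 else 0 := by
  rw [p_eq_bas ν k (by simp), bas_apply_zero]

theorem p_neg_one_apply_one (N k : ℕ) : p N (-1) k 1 = if k = N then 1 else 0 := by
  have hgen : gen N (-1) = fun x : ℝ => (1 - x) ^ N := by
    ext x
    have : -((N : ℝ) / ((-1 : ℤ) : ℝ)) = N := by push_cast; ring
    rw [gen, if_neg (by norm_num), this, Real.rpow_natCast]
    push_cast
    ring
  rw [p, hgen, iteratedDeriv_comp_const_sub k (fun x : ℝ => x ^ N) 1]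
  simp only [sub_self, smul_eq_mul, iteratedDeriv_fun_pow_zero]
  by_cases h : k = N
  · subst h
    have : ((-1 : ℝ) ^ k) * (-1) ^ k = 1 := by rw [← mul_pow]; simp
    have hk : (k.factorial : ℝ) ≠ 0 := by positivity
    simp
    field_simp
    linarith
  · simp [h]

/-! ### The estimate -/

/-- The three contributions to the constant are `5` from the constant part of the chaining bound,
`4` from the second moment and `2` from the reciprocal moment. -/
theorem abs_F_sub_le_omega {n N : ℕ} {m c : ℤ} (hN : (N : ℤ) = n + m * c) (hc : -1 ≤ c)
    (hN5 : 5 ≤ N) (hcN : 3 * c + 5 ≤ N) (hn : 0 < n) (hnN : (n : ℤ) ≤ 2 * (N - c))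
    {α β : ℝ} (hα : 1 ≤ α) (hβ₀ : 0 ≤ β) (hβ₁ : β ≤ 1) {f : ℝ → ℝ}
    (hf : ContinuousOn f (dom c)) {M : ℝ} (hM : ∀ x ∈ dom c, |f x| ≤ M) {x : ℝ}
    (hx₀ : 0 < x) (hx : 0 < 1 + (c : ℝ) * x) :
    |F n m c α f x - f x| ≤ 11 * α * omega c β f (phi c x ^ (1 - β) / √n) := by
  obtain ⟨h0, h1, h2, h3⟩ := cast_bounds hc hN5 hcN
  have hn' : (0 : ℝ) < n := by exact_mod_cast hn
  have hr : 0 < √(n : ℝ) := Real.sqrt_pos.2 hn'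
  have hstep := stepBound_omega hβ₀ hβ₁ hM x hr
  have hΛ := omega_nonneg c β f (phi c x ^ (1 - β) / √n)
  set Λ := omega c β f (phi c x ^ (1 - β) / √n) with hΛdef
  have hφ : 0 < phi c x := Real.sqrt_pos.2 (mul_pos hx₀ hx)
  -- The reciprocal term of the majorant only appears on the half-line.
  obtain ⟨e, he₀, he, hex, hdev⟩ : ∃ e : ℝ, 0 ≤ e ∧ (e = 0 ∨ 0 ≤ c) ∧ e ≤ Λ * (1 + c * x) ∧
      ∀ t ∈ dom c, |f t - f x| ≤
        Λ * 5 + Λ * (n / phi c x ^ 2) * (t - x) ^ 2 + e / (1 + c * t) := by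
    rcases hc.eq_or_lt with rfl | hc'
    · refine ⟨0, le_rfl, Or.inl rfl, by positivity, fun t ht => ?_⟩
      rw [dom_neg_one] at ht
      push_cast at hx
      refine (hstep.deviation_neg_one hΛ hr hx₀ (by linarith) ht.1 ht.2).trans (le_of_eq ?_)
      rw [Real.sq_sqrt hn'.le]
      ring
    · have hc0 : 0 ≤ c := by omega
      refine ⟨Λ * (1 + c * x), by positivity, Or.inr hc0, le_rfl, fun t ht => ?_⟩
      rw [dom_of_nonneg hc0] at ht
      refine (hstep.deviation_of_nonneg hc0 hΛ hr hx₀ ht).trans ?_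
      rw [Real.sq_sqrt hn'.le]
      have : Λ * (4 + n * (t - x) ^ 2 / phi c x ^ 2 + (1 + c * x) / (1 + c * t)) =
          Λ * 4 + Λ * (n / phi c x ^ 2) * (t - x) ^ 2 + Λ * (1 + c * x) / (1 + c * t) := by ring
      rw [this]
      linarith
  refine (abs_F_sub_le hN hc hN5 hcN hα hf hx₀.le hx he₀ he hdev).trans ?_
  have hquad : Λ * (n / phi c x ^ 2) * (2 * phi c x ^ 2 / (N - c)) ≤ Λ * 4 := by
    have e1 : Λ * (n / phi c x ^ 2) * (2 * phi c x ^ 2 / (N - c)) = Λ * (2 * n / (N - c)) := by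
      field_simp
    rw [e1]
    refine mul_le_mul_of_nonneg_left ((div_le_iff₀ h2).2 ?_) hΛ
    have : (n : ℝ) ≤ 2 * (N - c) := by exact_mod_cast hnN
    linarith
  have hrecip : e * ((N + c) / ((N - c) * (1 + c * x))) ≤ Λ * 2 := by
    have hcN' : (N : ℝ) + c ≤ 2 * (N - c) := by
      exact_mod_cast (by omega : (N : ℤ) + c ≤ 2 * (N - c))
    calc e * ((N + c) / ((N - c) * (1 + c * x)))
        ≤ Λ * (1 + c * x) * ((N + c) / ((N - c) * (1 + c * x))) := by gcongr
      _ = Λ * ((N + c) / (N - c)) := by field_simp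
      _ ≤ Λ * 2 := mul_le_mul_of_nonneg_left ((div_le_iff₀ h2).2 hcN') hΛ
  calc _ ≤ α * (Λ * 5 + Λ * 4 + Λ * 2) := by gcongr
    _ = 11 * α * Λ := by ring

theorem F_eq_self_of_endpoint {n N : ℕ} {m c : ℤ} (hN : (N : ℤ) = n + m * c) (hc : -1 ≤ c)
    (hN5 : 5 ≤ N) {α : ℝ} (hα : 1 ≤ α) (f : ℝ → ℝ) {x : ℝ}
    (hx : x ∈ dom c) (hend : ¬(0 < x ∧ 0 < 1 + (c : ℝ) * x)) : F n m c α f x = f x := by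
  rcases hx.1.eq_or_lt with rfl | hx0
  · rw [F_of_point_mass hN (by linarith) f (p_apply_zero N c)]
    have : ¬ (c = -1 ∧ 0 = N) := by omega
    simp [node, this]
  · have hx1 : 1 + (c : ℝ) * x = 0 := le_antisymm (not_lt.1 fun h => hend ⟨hx0, h⟩) hx.2
    have hc1 : c = -1 := by
      rcases hc.eq_or_lt with h | h
      · exact h.symm
      · have : (0 : ℝ) ≤ c := by exact_mod_cast (by omega : 0 ≤ c)
        have : 0 < 1 + (c : ℝ) * x := by positivity
        linarith
    subst hc1
    obtain rfl : x = 1 := by push_cast at hx1; linarith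
    rw [F_of_point_mass hN (by linarith) f (p_neg_one_apply_one N), node,
      setIntegral_p_mul_eq_zero (by omega) (by omega)]
    simp [show N ≠ 0 by omega]

end GuptaSrivastava

theorem theorem2 (c : ℤ) (hc : -1 ≤ c) (m : ℤ) (α : ℝ) (hα : 1 ≤ α)
    (β : ℝ) (hβ₀ : 0 ≤ β) (hβ₁ : β ≤ 1) :
    ∃ C : ℝ, 0 < C ∧ ∀ᶠ n : ℕ in atTop, ∀ f : ℝ → ℝ,
      ContinuousOn f (GuptaSrivastava.dom c) →
      (∃ M : ℝ, ∀ x ∈ GuptaSrivastava.dom c, |f x| ≤ M) →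
      ∀ x ∈ GuptaSrivastava.dom c,
        |GuptaSrivastava.F n m c α f x - f x| ≤
          C * GuptaSrivastava.omega c β f
            (GuptaSrivastava.phi c x ^ (1 - β) / Real.sqrt n) := by
  refine ⟨11 * α, by linarith, ?_⟩
  filter_upwards [eventually_ge_atTop (2 * (m * c).natAbs + 3 * c.natAbs + 5)] with n hn
  obtain ⟨N, hN⟩ : ∃ N : ℕ, (N : ℤ) = n + m * c := ⟨(n + m * c).toNat, by omega⟩
  rintro f hf ⟨M, hM⟩ x hx
  by_cases hint : 0 < x ∧ 0 < 1 + (c : ℝ) * x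
  · exact GuptaSrivastava.abs_F_sub_le_omega hN hc (by omega) (by omega) (by omega) (by omega)
      hα hβ₀ hβ₁ hf hM hint.1 hint.2
  · rw [GuptaSrivastava.F_eq_self_of_endpoint hN hc (by omega) hα f hx hint, sub_self,
      abs_zero]
    exact mul_nonneg (by linarith) (GuptaSrivastava.omega_nonneg _ _ _ _)
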